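/- **Setting.** Let $s=n^2$ be a perfect square and consider a generalized Sudoku puzzle: a partially filled $s\times s$ grid, to be completed so that each row, each column and each of the $s$ sub-grids of size $n\times n$ contains all digits $1,\dots,s$. In the lifted formulation the unknown is $x\in\mathbb R^{s\times s\times s}$ (with the Euclidean norm), where $x(i,j,\cdot)$ encodes the digit in cell $(i,j)$, and with $e=(1,0,\dots,0)$ the constraint sets are: $C_1$: every row $x(:,j,k)$ is a permutation of $e$; $C_2$: every column $x(i,:,k)$ is a permutation of $e$; $C_3$: every pillar $x(i,j,:)$ is a permutation of $e$; $C_4$: for every $k$, each of the $s$ sub-grids of size $n\times n$ of $x(:,:,k)$ is a permutation of $e$; $C_5$: the affine subspace of all $x$ such that $x(i,j,:)$ is the $d$-th unit vector whenever the digit $d$ is provided in cell $(i,j)$. Put $\mathcal H=(\mathbb R^{s\times s\times s})^5$ with $\|\boldsymbol x\|^2=\sum_i\|x_i\|^2$, $\mathcal C=C_1\times\dots\times C_5$ and $\mathcal S=\{\boldsymbol x\in\mathcal H: x_1=\dots=x_5\}$. For a non-empty closed set $C$ let $P_C(x)=\{y\in C:\|x-y\|=\mathrm{dist}(x,C)\}$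 and $P_C^{\lambda}=\lambda P_C+(1-\lambda)\mathrm{Id}$. The limiting normal cone $N_C(x)$ is the set of limits of vectors $v_k$ such that $v_k=t_k(w_k-x_k)$ with $t_k\ge 0$, $x_k\in P_C(w_k)$ and $x_k\to x$. A point $x\in C$ is stationary for $\min\{f(x): x\in C\}$ if $f$ is differentiable at $x$ and $0\in\nabla f(x)+N_C(x)$. The damped Douglas–Rachford method with parameter $\gamma>0$, started at an arbitrary $\boldsymbol z_0\in\mathcal H$, is, for $k\ge 0$ and $i=1,\dots,5$, $$x_{i,k+1}=\tfrac1{1+\gamma}\Big(z_{i,k}+\gamma\,\tfrac15\sum_{j=1}^5 z_{j,k}\Big),\qquad u_{i,k+1}\in P_{C_i}(2x_{i,k+1}-z_{i,k}),\qquad z_{i,k+1}=z_{i,k}+u_{i,k+1}-x_{i,k+1},$$ and its set-valued fixed-point operator is $\mathcal F_\gamma=\frac12\big((2P_{\mathcal C}-\mathrm{Id})(2P_{\mathcal S}^{\gamma/(1+\gamma)}-\mathrm{Id})+\mathrm{Id}\big)$. **Proposition.** Suppose $\mathcal C\cap\mathcal S\neq\emptyset$ (the puzzle has a solution) and $0<\gamma<\sqrt{3/2}-1$.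 Then every sequence $(\boldsymbol u_k,\boldsymbol x_k,\boldsymbol z_k)$ generated by the method converges to some $(\boldsymbol x^\star,\boldsymbol x^\star,\boldsymbol z^\star)$, where $\boldsymbol z^\star\in\mathcal F_\gamma(\boldsymbol z^\star)$ is a fixed point and $\boldsymbol x^\star=P_{\mathcal S}^{\gamma/(1+\gamma)}(\boldsymbol z^\star)$ is a stationary point of $\min_{\boldsymbol x}\{\mathrm{dist}^2(\boldsymbol x,\mathcal S): \boldsymbol x\in\mathcal C\}$. If, moreover, the non-degeneracy condition $x_i^\star-z_i^\star\in\mathrm{int}\big(N_{C_i}(x_i^\star)\big)$ holds for $i=1,\dots,4$, then: - for all $k$ large enough, $u_{i,k}=x_i^\star$ for $i=1,\dots,4$; - $\|\boldsymbol z_k-\boldsymbol z^\star\|=O(\eta^k)$ with $\eta=\dfrac{2\gamma+5+\sqrt{25-16\gamma^2}}{10(1+\gamma)}$; - for all $k$ large enough, $\boldsymbol z_{k+1}-\boldsymbol z^\star=M_\gamma(\boldsymbol z_k-\boldsymbol z^\star)$ with the iteration matrix $M_\gamma=\frac1{1+\gamma}\big(\gamma(\mathrm{Id}+2\Pi_{\mathcal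 C}P_{\mathcal S}-\Pi_{\mathcal C}-P_{\mathcal S})+\Pi_{\mathcal C}\big)$, where $P_{\mathcal S}=\frac15\mathbf 1_{5\times5}\otimes\mathrm{Id}$ and $\Pi_{\mathcal C}=\mathrm{diag}(0,0,0,0,\Pi_5)$, with $\Pi_5$ the orthogonal projection onto the linear subspace parallel to $C_5$. Finally, if at least one cell of the given grid is blank, then $\eta$ is a semi-simple eigenvalue of $M_\gamma$, that is, an eigenvalue with $\mathrm{rank}(M_\gamma-\eta\,\mathrm{Id})=\mathrm{rank}\big((M_\gamma-\eta\,\mathrm{Id})^2\big)$. -/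

import Mathlib

noncomputable section

namespace DampedDR

/-! ### Projections, normal cones, stationarity -/

section General

variable {E : Type*} [NormedAddCommGroup E]

/-- The (set-valued) projection of `x` onto `C`. -/
def proj (C : Set E) (x : E) : Set E :=
  {y | y ∈ C ∧ ‖x - y‖ = Metric.infDist x C}

variable [InnerProductSpace ℝ E]

/-- The relaxed projection `P_C^l = l P_C + (1 - l) Id` (set-valued). -/
def relaxedProj (l : ℝ) (C : Set E) (x : E) : Set E :=
  {w | ∃ y ∈ proj C x, w = l • y + (1 - l) • x}

/-- The proximal normal cone `cone (P_C⁻¹(x) - x)` of `C` at `x`. -/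
def proximalNormalCone (C : Set E) (x : E) : Set E :=
  {v | ∃ t : ℝ, 0 ≤ t ∧ ∃ w : E, x ∈ proj C w ∧ v = t • (w - x)}

/-- The limiting normal cone of `C` at `x`: limits of proximal normals at points of `C`
converging to `x`. -/
def limitingNormalCone (C : Set E) (x : E) : Set E :=
  {v | ∃ (xs vs : ℕ → E), (∀ k, xs k ∈ C ∧ vs k ∈ proximalNormalCone C (xs k)) ∧
    Filter.Tendsto xs Filter.atTop (nhds x) ∧ Filter.Tendsto vs Filter.atTop (nhds v)}

/-- `x` is a stationary point of `min f` subject to `x ∈ C`: `f` is differentiable at `x ∈ C`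
and `0 ∈ ∇f(x) + N_C(x)`. -/
def IsStationaryPoint [CompleteSpace E] (f : E → ℝ) (C : Set E) (x : E) : Prop :=
  x ∈ C ∧ ∃ g : E, HasGradientAt f g x ∧ -g ∈ limitingNormalCone C x

/-- The set-valued fixed-point operator of the damped Douglas–Rachford method,
`½ ((2 P_C - Id)(2 P_S^{γ/(1+γ)} - Id) + Id)`. -/
def ddrOperator (γ : ℝ) (C S : Set E) (z : E) : Set E :=
  {w | ∃ x ∈ relaxedProj (γ / (1 + γ)) S z, ∃ u ∈ proj C ((2 : ℝ) • x - z),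
    w = (1 / 2 : ℝ) • (((2 : ℝ) • u - ((2 : ℝ) • x - z)) + z)}

end General

/-! ### The product space and the iteration -/

section Product

variable {m : ℕ} {E : Type*}

/-- The product `C₁ × ⋯ × C_m` in `E^m` (with the `ℓ²` product norm). -/
def prodSet (C : Fin m → Set E) : Set (PiLp 2 fun _ : Fin m => E) :=
  {x | ∀ i, x i ∈ C i}

/-- The diagonal subspace `{x : x₁ = ⋯ = x_m}` of `E^m`. -/
def diagonalSet (m : ℕ) (E : Type*) : Set (PiLp 2 fun _ : Fin m => E) :=
  {x | ∀ i j, x i = x j}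

/-- `(u_k, x_k, z_k)` is generated by the damped Douglas–Rachford method with parameter `γ` for
the sets `C₁, …, C_m`. The starting point `z 0` is arbitrary; `x 0` and `u 0` play no role. -/
def IsDDRSequence [NormedAddCommGroup E] [InnerProductSpace ℝ E] (γ : ℝ) (C : Fin m → Set E)
    (u x z : ℕ → PiLp 2 fun _ : Fin m => E) : Prop :=
  ∀ k i,
    x (k + 1) i = (1 / (1 + γ)) • (z k i + γ • ((1 / (m : ℝ)) • ∑ j, z k j)) ∧
    u (k + 1) i ∈ proj (C i) ((2 : ℝ) • x (k + 1) i - z k i) ∧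
    z (k + 1) i = z k i + u (k + 1) i - x (k + 1) i

end Product

/-- `η` is a semi-simple eigenvalue of `M`: an eigenvalue with
`rank (M - η Id) = rank ((M - η Id)²)`. -/
def IsSemisimpleEigenvalue {ι : Type*} [Fintype ι] [DecidableEq ι] (M : Matrix ι ι ℝ) (η : ℝ) :
    Prop :=
  Module.End.HasEigenvalue (Matrix.toLin' M) η ∧
    (M - η • (1 : Matrix ι ι ℝ)).rank = ((M - η • (1 : Matrix ι ι ℝ)) ^ 2).rank

/-! ### The lifted Sudoku problem on an `s × s` grid, `s = n²` -/

/-- Positions `(i, j, k)` of the `s × s × s` cube, `s = n²`. Here `(i, j)` is a cell of the grid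
and `k` a digit. -/
abbrev Pos (n : ℕ) : Type := Fin (n ^ 2) × Fin (n ^ 2) × Fin (n ^ 2)

/-- `ℝ^{s × s × s}` with its Euclidean structure. -/
abbrev Cube (n : ℕ) : Type := EuclideanSpace ℝ (Pos n)

/-- The five-fold product of `ℝ^{s × s × s}`. -/
abbrev Cube5 (n : ℕ) : Type := PiLp 2 fun _ : Fin 5 => Cube n

/-- The entries of `x` at the positions in `L` are a permutation of `(1, 0, …, 0)`. -/
def IsUnitOn {n : ℕ} (x : Cube n) (L : Set (Pos n)) : Prop :=
  ∃ p ∈ L, x p = 1 ∧ ∀ q ∈ L, q ≠ p → x q = 0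

/-- Each row `(:, j, k)` is a permutation of `(1, 0, …, 0)`. -/
def C₁ (n : ℕ) : Set (Cube n) :=
  {x | ∀ j k, IsUnitOn x {p | p.2.1 = j ∧ p.2.2 = k}}

/-- Each column `(i, :, k)` is a permutation of `(1, 0, …, 0)`. -/
def C₂ (n : ℕ) : Set (Cube n) :=
  {x | ∀ i k, IsUnitOn x {p | p.1 = i ∧ p.2.2 = k}}

/-- Each pillar `(i, j, :)` is a permutation of `(1, 0, …, 0)`. -/
def C₃ (n : ℕ) : Set (Cube n) :=
  {x | ∀ i j, IsUnitOn x {p | p.1 = i ∧ p.2.1 = j}}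

/-- For each digit `k`, each of the `s` sub-grids of size `n × n` is a permutation of
`(1, 0, …, 0)`. With indices from `0`, the sub-grid `(a, b)` consists of the cells `(i, j)` with
`n a ≤ i < n (a + 1)` and `n b ≤ j < n (b + 1)`. -/
def C₄ (n : ℕ) : Set (Cube n) :=
  {x | ∀ (a b : Fin n) (k : Fin (n ^ 2)),
    IsUnitOn x {p | (p.1 : ℕ) / n = a ∧ (p.2.1 : ℕ) / n = b ∧ p.2.2 = k}}

/-- A partially completed grid: `given i j = some d` if the digit `d` is provided in the cell
`(i, j)`, and `given i j = none` if the cell is blank. -/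
abbrev Grid (n : ℕ) : Type := Fin (n ^ 2) → Fin (n ^ 2) → Option (Fin (n ^ 2))

/-- The constraint of the provided numbers: the pillar over a cell with the provided digit `d` is
the `d`-th unit vector. -/
def C₅ {n : ℕ} (given : Grid n) : Set (Cube n) :=
  {x | ∀ i j d, given i j = some d → ∀ k, x (i, j, k) = if k = d then 1 else 0}

/-- The five constraint sets, indexed from `0`. -/
def sudokuSets {n : ℕ} (given : Grid n) : Fin 5 → Set (Cube n) :=
  ![C₁ n, C₂ n, C₃ n, C₄ n, C₅ given]

/-! ### The iteration matrix -/

/-- The vector of all coordinates of an element of the product space. -/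
def flat {n : ℕ} (z : Cube5 n) : Fin 5 × Pos n → ℝ := fun p => z p.1 p.2

/-- The matrix `(1/5) 1_{5×5} ⊗ Id` of the projection onto the diagonal. -/
def matS (n : ℕ) : Matrix (Fin 5 × Pos n) (Fin 5 × Pos n) ℝ :=
  Matrix.kroneckerMap (· * ·) ((1 / 5 : ℝ) • Matrix.of fun _ _ : Fin 5 => (1 : ℝ))
    (1 : Matrix (Pos n) (Pos n) ℝ)

/-- The matrix `diag(0, 0, 0, 0, P)`, where `P` is the linear part of the projection onto the
affine subspace `C₅`: it keeps the coordinates over blank cells and annihilates the others. -/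
def matC {n : ℕ} (given : Grid n) : Matrix (Fin 5 × Pos n) (Fin 5 × Pos n) ℝ :=
  Matrix.diagonal fun p => if p.1 = 4 ∧ given p.2.1 p.2.2.1 = none then 1 else 0

/-- The matrix `M_γ = (1/(1+γ)) (γ (Id + 2 P_C P_S - P_C - P_S) + P_C)`. -/
def iterationMatrix {n : ℕ} (γ : ℝ) (given : Grid n) :
    Matrix (Fin 5 × Pos n) (Fin 5 × Pos n) ℝ :=
  (1 / (1 + γ)) • (γ • (1 + (2 : ℝ) • (matC given * matS n) - matC given - matS n) + matC given)

/-- `η = (2γ + 5 + √(25 - 16γ²)) / (10 (1 + γ))`. -/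
def rate (γ : ℝ) : ℝ := (2 * γ + 5 + Real.sqrt (25 - 16 * γ ^ 2)) / (10 * (1 + γ))

end DampedDR

end

/-
With `f = ½ dist²(·, S)`, the method is Douglas–Rachford splitting for `f` plus the indicator of
the product set, and the Douglas–Rachford merit function decreases by at least
`(1 - γ) / (2γ) ‖x_{k+1} - x_k‖²` per step. Hence consecutive iterates get arbitrarily close. Points
of `C₁, …, C₄` have entries in `{0, 1}`, so the first four components of `u_k` are eventually
constant, and from then on the increments of `z_k` satisfy the linear recursion with matrix `M_γ`.

Convergence and its rate thus follow from the spectrum of `M = M_γ`. The projections `P = Π_C` and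
`S = P_S` satisfy `P S P = P / 5`; therefore `M S = P S`, the span of `P` and `S P` is stable under
left multiplication by `M`, with characteristic roots `η' < η` there, and `M - γ/(1+γ)` is a sum of
a multiple `P (⋯)` and a multiple of `S`. So `M (M - η') (M - γ/(1+γ)) (M - η) = 0` with four
distinct real roots in `[0, η]`: `M` is diagonalizable and `M^k = O(η^k)`.
-/

noncomputable section

namespace DampedDR

open Filter Topology
open Polynomial (X aeval)

section Projection

variable {E : Type*} [NormedAddCommGroup E]

theorem mem_proj_iff {C : Set E} {x y : E} :
    y ∈ proj C x ↔ y ∈ C ∧ ∀ y' ∈ C, ‖x - y‖ ≤ ‖x - y'‖ := by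
  simp only [← dist_eq_norm]
  refine and_congr_right fun hy => ⟨fun h y' hy' => ?_, fun h => le_antisymm ?_ ?_⟩
  · rw [dist_eq_norm, h]
    exact Metric.infDist_le_dist_of_mem hy'
  · rw [← dist_eq_norm]
    exact (Metric.le_infDist ⟨y, hy⟩).2 fun {y'} hy' => h y' hy'
  · rw [← dist_eq_norm]
    exact Metric.infDist_le_dist_of_mem hy

theorem mem_proj_of_tendsto {ι : Type*} {l : Filter ι} [l.NeBot] {C : Set E} (hC : IsClosed C)
    {w u : ι → E} {w' u' : E} (hw : Tendsto w l (𝓝 w')) (hu : Tendsto u l (𝓝 u'))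
    (h : ∀ k, u k ∈ proj C (w k)) : u' ∈ proj C w' :=
  ⟨hC.mem_of_tendsto hu (Eventually.of_forall fun k => (h k).1),
    tendsto_nhds_unique ((hw.sub hu).norm.congr fun k => (h k).2)
      (((Metric.continuous_infDist_pt C).tendsto w').comp hw)⟩

theorem mem_proj_prodSet {m : ℕ} {C : Fin m → Set E} {u w : PiLp 2 fun _ : Fin m => E}
    (h : ∀ i, u i ∈ proj (C i) (w i)) : u ∈ proj (prodSet C) w := by
  refine mem_proj_iff.2 ⟨fun i => (h i).1, fun y hy => ?_⟩
  rw [PiLp.norm_eq_of_L2, PiLp.norm_eq_of_L2]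
  gcongr with i
  exact (mem_proj_iff.1 (h i)).2 (y i) (hy i)

theorem isClosed_prodSet {m : ℕ} {C : Fin m → Set E} (hC : ∀ i, IsClosed (C i)) :
    IsClosed (prodSet C) := by
  simp only [prodSet, Set.ofPred_forall]
  exact isClosed_iInter fun i => (hC i).preimage (PiLp.continuous_apply 2 _ i)

end Projection

section Subspace

variable {H : Type*} [NormedAddCommGroup H] [InnerProductSpace ℝ H]
  (K : Submodule ℝ H) [K.HasOrthogonalProjection]

theorem infDist_submodule (x : H) :
    Metric.infDist x (K : Set H) = ‖Kᗮ.starProjection x‖ := by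
  rw [Metric.infDist_eq_iInf, Submodule.starProjection_orthogonal_val, K.starProjection_minimal]
  simp only [dist_eq_norm]
  rfl

theorem proj_submodule (x : H) : proj (K : Set H) x = {K.starProjection x} := by
  ext y
  refine ⟨fun ⟨hy, hxy⟩ => ?_, ?_⟩
  · refine (K.eq_starProjection_of_mem_of_inner_eq_zero hy ?_).symm
    refine (K.norm_eq_iInf_iff_real_inner_eq_zero hy).1 ?_
    rw [hxy, infDist_submodule, Submodule.starProjection_orthogonal_val, K.starProjection_minimal]
    rfl
  · rintro rfl
    refine ⟨K.starProjection_apply_mem x, ?_⟩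
    rw [infDist_submodule, Submodule.starProjection_orthogonal_val]

theorem inner_starProjection_left (x y : H) :
    inner ℝ (K.starProjection x) y = inner ℝ (K.starProjection x) (K.starProjection y) := by
  rw [← Submodule.inner_starProjection_left_eq_right,
    Submodule.starProjection_eq_self_iff.2 (K.starProjection_apply_mem x)]

theorem hasGradientAt_infDist_submodule_sq [CompleteSpace H] (x : H) :
    HasGradientAt (fun y => Metric.infDist y (K : Set H) ^ 2)
      ((2 : ℝ) • Kᗮ.starProjection x) x := by
  simp only [infDist_submodule]
  rw [hasGradientAt_iff_hasFDerivAt]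
  refine (Kᗮ.starProjection.hasFDerivAt (x := x)).norm_sq.congr_fderiv ?_
  ext y
  simpa [real_inner_smul_left, -Submodule.starProjection_orthogonal_val] using
    (inner_starProjection_left Kᗮ x y).symm

/-- The single-valued relaxed projection `P_K^{γ/(1+γ)}` onto a subspace, which is also the
proximal map of `γ/2 dist²(·, K)`; it sends the iterate `z_k` of the damped Douglas–Rachford method
to its shadow `x_{k+1}`. -/
def shadow (γ : ℝ) : H →L[ℝ] H :=
  (1 / (1 + γ)) • (ContinuousLinearMap.id ℝ H + γ • K.starProjection)

theorem shadow_apply (γ : ℝ) (z : H) :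
    shadow K γ z = (1 / (1 + γ)) • (z + γ • K.starProjection z) :=
  rfl

theorem relaxedProj_submodule {γ : ℝ} (hγ : 1 + γ ≠ 0) (z : H) :
    relaxedProj (γ / (1 + γ)) (K : Set H) z = {shadow K γ z} := by
  have hshadow : shadow K γ z =
      (γ / (1 + γ)) • K.starProjection z + (1 - γ / (1 + γ)) • z := by
    rw [shadow_apply]
    match_scalars <;> field_simp
    ring
  simp [relaxedProj, proj_submodule, hshadow]

theorem shadow_add_smul {γ : ℝ} (hγ : 1 + γ ≠ 0) (z : H) :
    shadow K γ z + γ • Kᗮ.starProjection (shadow K γ z) = z := by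
  have hP : K.starProjection (shadow K γ z) = K.starProjection z := by
    rw [shadow_apply, map_smul, map_add, map_smul,
      Submodule.starProjection_eq_self_iff.2 (K.starProjection_apply_mem z)]
    match_scalars
    field_simp
  rw [Submodule.starProjection_orthogonal_val, hP, shadow_apply]
  match_scalars <;> field_simp
  ring

theorem mem_ddrOperator_submodule {γ : ℝ} (hγ : 1 + γ ≠ 0) {C : Set H} {w z : H} :
    w ∈ ddrOperator γ C (K : Set H) z ↔
      w - z + shadow K γ z ∈ proj C ((2 : ℝ) • shadow K γ z - z) := by
  simp only [ddrOperator, relaxedProj_submodule K hγ, Set.mem_singleton_iff, exists_eq_left]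
  constructor
  · rintro ⟨u, hu, rfl⟩
    convert hu using 1
    module
  · exact fun h => ⟨_, h, by module⟩

theorem mem_ddrOperator_of_tendsto {γ : ℝ} (hγ : 1 + γ ≠ 0) {C : Set H} (hC : IsClosed C)
    {z : ℕ → H} {z' : H} (hz : Tendsto z atTop (𝓝 z'))
    (h : ∀ k, z (k + 1) ∈ ddrOperator γ C (K : Set H) (z k)) :
    z' ∈ ddrOperator γ C (K : Set H) z' := by
  have hx : Tendsto (fun k => shadow K γ (z k)) atTop (𝓝 (shadow K γ z')) :=
    ((shadow K γ).continuous.tendsto z').comp hz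
  rw [mem_ddrOperator_submodule K hγ]
  exact mem_proj_of_tendsto hC ((hx.const_smul (2 : ℝ)).sub hz)
    (((hz.comp (tendsto_add_atTop_nat 1)).sub hz).add hx)
    fun k => (mem_ddrOperator_submodule K hγ).1 (h k)

theorem isStationaryPoint_shadow [CompleteSpace H] {γ : ℝ} (hγ : 0 < γ) {C : Set H} {z : H}
    (hz : z ∈ ddrOperator γ C (K : Set H) z) :
    IsStationaryPoint (fun y => Metric.infDist y (K : Set H) ^ 2) C (shadow K γ z) := by
  have hγ' : 1 + γ ≠ 0 := by positivity
  have hproj := (mem_ddrOperator_submodule K hγ').1 hz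
  rw [sub_self, zero_add] at hproj
  have hnormal : -((2 : ℝ) • Kᗮ.starProjection (shadow K γ z)) ∈
      proximalNormalCone C (shadow K γ z) := by
    refine ⟨2 / γ, by positivity, _, hproj, ?_⟩
    have hz' := shadow_add_smul K hγ' z
    generalize shadow K γ z = x at hz' ⊢
    rw [← hz']
    match_scalars <;> field_simp
    ring
  exact ⟨hproj.1, _, hasGradientAt_infDist_submodule_sq K _, fun _ => _, fun _ => _,
    fun _ => ⟨hproj.1, hnormal⟩, tendsto_const_nhds, tendsto_const_nhds⟩

end Subspace

section Descent

theorem tendsto_zero_of_le_sub_succ {a V : ℕ → ℝ} (ha : ∀ k, 0 ≤ a k) (hV : ∀ k, 0 ≤ V k)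
    (h : ∀ k, a k ≤ V k - V (k + 1)) : Tendsto a atTop (𝓝 0) := by
  have hanti : Antitone V := antitone_nat_of_succ_le fun k => by linarith [ha k, h k]
  have hlim := tendsto_atTop_ciInf hanti ⟨0, Set.forall_mem_range.2 hV⟩
  have hdiff := hlim.sub (hlim.comp (tendsto_add_atTop_nat 1))
  rw [sub_self] at hdiff
  exact squeeze_zero ha h hdiff

variable {H : Type*} [NormedAddCommGroup H] [InnerProductSpace ℝ H]
  (K : Submodule ℝ H) [K.HasOrthogonalProjection] {γ : ℝ} {C : Set H}

/-- The Douglas–Rachford merit function `f(x) + ⟨∇f(x), u - x⟩ + ‖u - x‖² / (2γ)` of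
`f = ½ dist²(·, K)`, written with the square completed. -/
def merit (γ : ℝ) (x u : H) : ℝ :=
  ‖x - γ • Kᗮ.starProjection x - u‖ ^ 2 / (2 * γ) + (1 - γ) / 2 * ‖Kᗮ.starProjection x‖ ^ 2

theorem merit_nonneg (hγ0 : 0 ≤ γ) (hγ1 : γ ≤ 1) (x u : H) : 0 ≤ merit K γ x u := by
  have := sub_nonneg.2 hγ1
  unfold merit
  positivity

theorem merit_le_of_mem_proj (hγ : 0 ≤ γ) {x u u' : H}
    (hu : u ∈ proj C (x - γ • Kᗮ.starProjection x)) (hu' : u' ∈ C) :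
    merit K γ x u ≤ merit K γ x u' := by
  unfold merit
  gcongr
  exact (mem_proj_iff.1 hu).2 u' hu'

theorem merit_sub_merit (hγ : γ ≠ 0) (x d : H) :
    merit K γ x (x + d + γ • Kᗮ.starProjection d) -
        merit K γ (x + d) (x + d + γ • Kᗮ.starProjection d) =
      (‖d‖ ^ 2 + γ * (1 - 2 * γ) * ‖Kᗮ.starProjection d‖ ^ 2) / (2 * γ) := by
  have hxd := inner_starProjection_left Kᗮ x d
  have hdd := inner_starProjection_left Kᗮ d d
  unfold merit
  rw [map_add]
  generalize Kᗮ.starProjection x = q at *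
  generalize Kᗮ.starProjection d = e at *
  have h₁ : x - γ • q - (x + d + γ • e) = -(d + γ • (q + e)) := by module
  have h₂ : x + d - γ • (q + e) - (x + d + γ • e) = -(γ • (q + (2 : ℝ) • e)) := by module
  rw [h₁, h₂, norm_neg, norm_neg]
  simp only [← real_inner_self_eq_norm_sq, inner_add_left, inner_add_right,
    real_inner_smul_left, real_inner_smul_right, real_inner_comm q e, real_inner_comm q d,
    real_inner_comm e d, hxd, hdd]
  field_simp
  ring

theorem le_merit_sub_merit (hγ0 : 0 < γ) (hγ1 : γ ≤ 1) (x d : H) :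
    (1 - γ) / (2 * γ) * ‖d‖ ^ 2 ≤ merit K γ x (x + d + γ • Kᗮ.starProjection d) -
        merit K γ (x + d) (x + d + γ • Kᗮ.starProjection d) := by
  have hQ : ‖Kᗮ.starProjection d‖ ^ 2 ≤ ‖d‖ ^ 2 := by
    gcongr
    exact Kᗮ.norm_starProjection_apply_le d
  rw [merit_sub_merit K hγ0.ne', div_mul_eq_mul_div]
  gcongr
  nlinarith [mul_le_mul_of_nonneg_left hQ hγ0.le,
    mul_nonneg (mul_nonneg hγ0.le (sub_nonneg.2 hγ1)) (sq_nonneg ‖Kᗮ.starProjection d‖)]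

theorem tendsto_shadow_sub_zero (hγ0 : 0 < γ) (hγ1 : γ < 1) {z : ℕ → H}
    (hz : ∀ k, z (k + 1) ∈ ddrOperator γ C (K : Set H) (z k)) :
    Tendsto (fun k => shadow K γ (z (k + 1)) - shadow K γ (z k)) atTop (𝓝 0) := by
  have hγ : 1 + γ ≠ 0 := by positivity
  set x := fun k => shadow K γ (z k)
  set u := fun k => z (k + 1) - z k + x k
  have hzx : ∀ k, x k + γ • Kᗮ.starProjection (x k) = z k := fun k => shadow_add_smul K hγ (z k)
  have hu : ∀ k, u k ∈ proj C (x k - γ • Kᗮ.starProjection (x k)) := fun k => by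
    convert (mem_ddrOperator_submodule K hγ).1 (hz k) using 2
    linear_combination (norm := module) -hzx k
  have hux : ∀ k, u k = x k + (x (k + 1) - x k) + γ • Kᗮ.starProjection (x (k + 1) - x k) := by
    intro k
    simp only [u]
    rw [map_sub]
    linear_combination (norm := module) hzx k - hzx (k + 1)
  have hdescent : ∀ k, (1 - γ) / (2 * γ) * ‖x (k + 1) - x k‖ ^ 2 ≤
      merit K γ (x k) (u k) - merit K γ (x (k + 1)) (u (k + 1)) := fun k => by
    have hle := le_merit_sub_merit K hγ0 hγ1.le (x k) (x (k + 1) - x k)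
    rw [← hux, add_sub_cancel] at hle
    linarith [merit_le_of_mem_proj K hγ0.le (hu (k + 1)) (hu k).1]
  have hc : 0 < (1 - γ) / (2 * γ) := div_pos (sub_pos.2 hγ1) (by positivity)
  have hsq := tendsto_zero_of_le_sub_succ (fun k => by positivity)
    (fun k => merit_nonneg K hγ0.le hγ1.le (x k) (u k)) hdescent
  have hsqrt := (hsq.const_mul ((1 - γ) / (2 * γ))⁻¹).sqrt
  simp only [inv_mul_cancel_left₀ hc.ne', mul_zero, Real.sqrt_zero,
    Real.sqrt_sq (norm_nonneg _)] at hsqrt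
  exact tendsto_zero_iff_norm_tendsto_zero.2 hsqrt

theorem tendsto_sub_zero_of_mem_ddrOperator (hγ0 : 0 < γ) (hγ1 : γ < 1) {z : ℕ → H}
    (hz : ∀ k, z (k + 1) ∈ ddrOperator γ C (K : Set H) (z k)) :
    Tendsto (fun k => z (k + 1) - z k) atTop (𝓝 0) := by
  have hγ : 1 + γ ≠ 0 := by positivity
  have hx := tendsto_shadow_sub_zero K hγ0 hγ1 hz
  have hQx := ((Kᗮ.starProjection.continuous.tendsto' 0 0 (map_zero _)).comp hx).const_smul γ
  rw [smul_zero] at hQx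
  rw [← add_zero (0 : H)]
  refine (hx.add hQx).congr fun k => ?_
  have h₀ := shadow_add_smul K hγ (z k)
  have h₁ := shadow_add_smul K hγ (z (k + 1))
  simp only [Function.comp_apply, map_sub]
  linear_combination (norm := module) h₁ - h₀

end Descent

section Diagonal

variable {m : ℕ} {E : Type*} [NormedAddCommGroup E] [InnerProductSpace ℝ E]

variable (m E) in
/-- The diagonal `diagonalSet m E` of `E^m` as a linear subspace. -/
def diagonalSubmodule : Submodule ℝ (PiLp 2 fun _ : Fin m => E) where
  carrier := diagonalSet m E
  add_mem' hx hy i j := by simp [hx i j, hy i j]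
  zero_mem' _ _ := by simp
  smul_mem' c x hx i j := by simp [hx i j]

theorem sub_mean_mem_orthogonal_diagonal (z : PiLp 2 fun _ : Fin m => E) :
    z - WithLp.toLp 2 (fun _ => (1 / (m : ℝ)) • ∑ j, z j) ∈ (diagonalSubmodule m E)ᗮ := by
  refine (Submodule.mem_orthogonal' _ _).2 fun w hw => ?_
  rcases m.eq_zero_or_pos with rfl | hm
  · simp [PiLp.inner_apply]
  · have hw' : ∀ j, w j = w ⟨0, hm⟩ := fun j => hw j _
    have hm' : (m : ℝ) ≠ 0 := by positivity
    simp only [PiLp.inner_apply, hw', ← sum_inner, PiLp.sub_apply, Finset.sum_sub_distrib,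
      Finset.sum_const, Finset.card_univ, Fintype.card_fin, ← Nat.cast_smul_eq_nsmul ℝ, smul_smul]
    rw [mul_one_div_cancel hm', one_smul, sub_self, inner_zero_left]

instance : (diagonalSubmodule m E).HasOrthogonalProjection where
  exists_orthogonal z := ⟨_, fun _ _ => rfl, sub_mean_mem_orthogonal_diagonal z⟩

theorem starProjection_diagonal_apply (z : PiLp 2 fun _ : Fin m => E) (i : Fin m) :
    (diagonalSubmodule m E).starProjection z i = (1 / (m : ℝ)) • ∑ j, z j := by
  have hmean : WithLp.toLp 2 (fun _ => (1 / (m : ℝ)) • ∑ j, z j) ∈ diagonalSubmodule m E :=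
    fun _ _ => rfl
  rw [Submodule.eq_starProjection_of_mem_orthogonal hmean (sub_mean_mem_orthogonal_diagonal z)]

end Diagonal

namespace IsDDRSequence

variable {m : ℕ} {E : Type*} [NormedAddCommGroup E] [InnerProductSpace ℝ E] {γ : ℝ}
  {C : Fin m → Set E} {u x z : ℕ → PiLp 2 fun _ : Fin m => E}

theorem x_succ (h : IsDDRSequence γ C u x z) (k : ℕ) :
    x (k + 1) = shadow (diagonalSubmodule m E) γ (z k) :=
  PiLp.ext fun i => by
    rw [(h k i).1, shadow_apply, PiLp.smul_apply, PiLp.add_apply, PiLp.smul_apply,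
      starProjection_diagonal_apply]

theorem z_succ (h : IsDDRSequence γ C u x z) (k : ℕ) : z (k + 1) = z k + u (k + 1) - x (k + 1) :=
  PiLp.ext fun i => (h k i).2.2

theorem u_succ (h : IsDDRSequence γ C u x z) (k : ℕ) :
    u (k + 1) = z (k + 1) - z k + shadow (diagonalSubmodule m E) γ (z k) := by
  rw [h.z_succ, ← h.x_succ]
  abel

theorem u_succ_mem (h : IsDDRSequence γ C u x z) (k : ℕ) (i : Fin m) : u (k + 1) i ∈ C i :=
  (h k i).2.1.1

theorem mem_ddrOperator (h : IsDDRSequence γ C u x z) (hγ : 1 + γ ≠ 0) (k : ℕ) :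
    z (k + 1) ∈ ddrOperator γ (prodSet C) (diagonalSet m E) (z k) := by
  refine (mem_ddrOperator_submodule (diagonalSubmodule m E) hγ).2 ?_
  rw [← h.u_succ, ← h.x_succ]
  exact mem_proj_prodSet fun i => (h k i).2.1

theorem tendsto_z_sub (h : IsDDRSequence γ C u x z) (hγ0 : 0 < γ) (hγ1 : γ < 1) :
    Tendsto (fun k => z (k + 1) - z k) atTop (𝓝 0) :=
  tendsto_sub_zero_of_mem_ddrOperator (diagonalSubmodule m E) hγ0 hγ1
    (h.mem_ddrOperator (by positivity))

theorem tendsto_u_sub (h : IsDDRSequence γ C u x z) (hγ0 : 0 < γ) (hγ1 : γ < 1) :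
    Tendsto (fun k => u (k + 2) - u (k + 1)) atTop (𝓝 0) := by
  have hz := h.tendsto_z_sub hγ0 hγ1
  have hshadow := ((shadow (diagonalSubmodule m E) γ).continuous.tendsto' 0 0 (map_zero _)).comp hz
  have hsum := ((hz.comp (tendsto_add_atTop_nat 1)).sub hz).add hshadow
  rw [sub_zero, add_zero] at hsum
  refine hsum.congr fun k => ?_
  rw [h.u_succ (k + 1), h.u_succ k]
  simp only [Function.comp_apply, map_sub]
  abel

theorem tendsto_x (h : IsDDRSequence γ C u x z) {z' : PiLp 2 fun _ : Fin m => E}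
    (hz : Tendsto z atTop (𝓝 z')) :
    Tendsto x atTop (𝓝 (shadow (diagonalSubmodule m E) γ z')) := by
  rw [← tendsto_add_atTop_iff_nat 1]
  simp only [h.x_succ]
  exact ((shadow (diagonalSubmodule m E) γ).continuous.tendsto z').comp hz

theorem tendsto_u (h : IsDDRSequence γ C u x z) {z' : PiLp 2 fun _ : Fin m => E}
    (hz : Tendsto z atTop (𝓝 z')) :
    Tendsto u atTop (𝓝 (shadow (diagonalSubmodule m E) γ z')) := by
  rw [← tendsto_add_atTop_iff_nat 1]
  have hsum := ((hz.comp (tendsto_add_atTop_nat 1)).sub hz).add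
    ((h.tendsto_x hz).comp (tendsto_add_atTop_nat 1))
  rw [sub_self, zero_add] at hsum
  refine hsum.congr fun k => ?_
  simp only [Function.comp_apply, h.u_succ, h.x_succ]

end IsDDRSequence

section Discrete

theorem eventually_succ_eq_of_pairwise_le_dist {E : Type*} [SeminormedAddCommGroup E] {s : Set E}
    {ε : ℝ} (hε : 0 < ε) (hs : s.Pairwise fun x y => ε ≤ dist x y) {f : ℕ → E}
    (hf : ∀ k, f k ∈ s) (h : Tendsto (fun k => f (k + 1) - f k) atTop (𝓝 0)) :
    ∀ᶠ k in atTop, f (k + 1) = f k := by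
  filter_upwards [(tendsto_zero_iff_norm_tendsto_zero.1 h).eventually_lt_const hε] with k hk
  rw [← dist_eq_norm] at hk
  exact hs.eq (hf (k + 1)) (hf k) (not_le.2 hk)

theorem eventually_eq_of_pairwise_le_dist {X : Type*} [MetricSpace X] {s : Set X}
    {ε : ℝ} (hε : 0 < ε) (hs : s.Pairwise fun x y => ε ≤ dist x y) {ι : Type*} {l : Filter ι}
    [l.NeBot] {f : ι → X} (hf : ∀ k, f k ∈ s) {a : X} (h : Tendsto f l (𝓝 a)) :
    ∀ᶠ k in l, f k = a := by
  have ha : a ∈ s :=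
    (Metric.isClosed_of_pairwise_le_dist hε hs).mem_of_tendsto h (Eventually.of_forall hf)
  filter_upwards [h.eventually (Metric.ball_mem_nhds a hε)] with k hk
  exact hs.eq (hf k) ha (not_le.2 hk)

end Discrete

section Sudoku

variable {n : ℕ} {given : Grid n}

theorem IsUnitOn.eq_zero_or_one {x : Cube n} {L : Set (Pos n)} (h : IsUnitOn x L) {p : Pos n}
    (hp : p ∈ L) : x p = 0 ∨ x p = 1 := by
  obtain ⟨q, -, hq, h0⟩ := h
  by_cases hpq : p = q
  · exact Or.inr (hpq ▸ hq)
  · exact Or.inl (h0 p hp hpq)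

theorem sudokuSets_eq_zero_or_one {i : Fin 5} (hi : i ≠ 4) {x : Cube n}
    (hx : x ∈ sudokuSets given i) (p : Pos n) : x p = 0 ∨ x p = 1 := by
  fin_cases i
  · exact IsUnitOn.eq_zero_or_one (hx p.2.1 p.2.2) ⟨rfl, rfl⟩
  · exact IsUnitOn.eq_zero_or_one (hx p.1 p.2.2) ⟨rfl, rfl⟩
  · exact IsUnitOn.eq_zero_or_one (hx p.1 p.2.1) ⟨rfl, rfl⟩
  · have hdiv : ∀ a : Fin (n ^ 2), (a : ℕ) / n < n := fun a =>
      Nat.div_lt_of_lt_mul ((sq n) ▸ a.2)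
    exact IsUnitOn.eq_zero_or_one (hx ⟨_, hdiv p.1⟩ ⟨_, hdiv p.2.1⟩ p.2.2) ⟨rfl, rfl, rfl⟩
  · exact absurd rfl hi

theorem pairwise_one_le_dist_sudokuSets {i : Fin 5} (hi : i ≠ 4) :
    (sudokuSets given i).Pairwise fun x y => 1 ≤ dist x y := by
  intro x hx y hy hxy
  obtain ⟨p, hp⟩ : ∃ p, x p ≠ y p := by
    contrapose! hxy
    exact PiLp.ext hxy
  have hxp := sudokuSets_eq_zero_or_one hi hx p
  have hyp := sudokuSets_eq_zero_or_one hi hy p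
  calc (1 : ℝ) ≤ ‖x p - y p‖ := by rcases hxp with h | h <;> rcases hyp with h' | h' <;> simp_all
    _ ≤ dist x y := (PiLp.norm_apply_le (x - y) p).trans_eq (dist_eq_norm x y).symm

theorem isClosed_C₅ : IsClosed (C₅ given) := by
  simp only [C₅, Set.ofPred_forall]
  exact isClosed_iInter fun i => isClosed_iInter fun j => isClosed_iInter fun d =>
    isClosed_iInter fun _ => isClosed_iInter fun k =>
      isClosed_eq (by fun_prop) continuous_const

theorem isClosed_sudokuSets (i : Fin 5) : IsClosed (sudokuSets given i) := by
  by_cases hi : i = 4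
  · exact hi ▸ isClosed_C₅
  · exact Metric.isClosed_of_pairwise_le_dist one_pos (pairwise_one_le_dist_sudokuSets hi)

theorem C₅_apply_eq {x y : Cube n} (hx : x ∈ C₅ given) (hy : y ∈ C₅ given)
    {p : Pos n} (hp : given p.1 p.2.1 ≠ none) : x p = y p := by
  obtain ⟨d, hd⟩ := Option.ne_none_iff_exists'.1 hp
  exact (hx _ _ d hd _).trans (hy _ _ d hd _).symm

theorem proj_C₅_apply_blank {u w : Cube n} (hu : u ∈ proj (C₅ given) w)
    {p : Pos n} (hp : given p.1 p.2.1 = none) : u p = w p := by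
  have h := (mem_proj_iff.1 hu).2 (u + EuclideanSpace.single p (w p - u p)) fun i j d hd k => by
    have hne : (i, j, k) ≠ p := by
      rintro rfl
      exact Option.some_ne_none d (hd.symm.trans hp)
    simpa [hne] using hu.1 i j d hd k
  rw [← sub_sub, ← sq_le_sq₀ (norm_nonneg _) (norm_nonneg _), norm_sub_sq_real (w - u),
    EuclideanSpace.inner_single_right, PiLp.norm_single] at h
  simp only [PiLp.sub_apply, conj_trivial, Real.norm_eq_abs, sq_abs] at h
  nlinarith [sq_nonneg (w p - u p)]

end Sudoku

section Coordinates

variable {n : ℕ} {given : Grid n}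

theorem flat_add (a b : Cube5 n) : flat (a + b) = flat a + flat b :=
  rfl

theorem flat_sub (a b : Cube5 n) : flat (a - b) = flat a - flat b :=
  rfl

theorem flat_smul (t : ℝ) (a : Cube5 n) : flat (t • a) = t • flat a :=
  rfl

variable (n) in
/-- The coordinate map `flat` as an isomorphism of topological vector spaces; through it the matrix
`iterationMatrix` acts on the product space. -/
def flatEquiv : Cube5 n ≃L[ℝ] (Fin 5 × Pos n → ℝ) where
  toFun := flat
  map_add' := flat_add
  map_smul' := flat_smul
  invFun v := WithLp.toLp 2 fun i => WithLp.toLp 2 fun p => v (i, p)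
  left_inv _ := rfl
  right_inv _ := rfl
  continuous_toFun := by
    unfold flat
    fun_prop
  continuous_invFun := by fun_prop

theorem matS_mulVec_apply (v : Fin 5 × Pos n → ℝ) (i : Fin 5) (p : Pos n) :
    (matS n).mulVec v (i, p) = (1 / 5) * ∑ j, v (j, p) := by
  simp only [Matrix.mulVec, dotProduct, matS, Matrix.kroneckerMap_apply, Matrix.smul_apply,
    Matrix.of_apply, smul_eq_mul, mul_one, Fintype.sum_prod_type (α₁ := Fin 5),
    Matrix.one_apply, mul_ite, mul_zero, ite_mul, zero_mul, Finset.sum_ite_eq,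
    Finset.mem_univ, if_true, Finset.mul_sum]

theorem flat_starProjection_diagonal (z : Cube5 n) :
    flat ((diagonalSubmodule 5 (Cube n)).starProjection z) = (matS n).mulVec (flat z) := by
  ext ⟨i, p⟩
  rw [matS_mulVec_apply]
  simp [flat, starProjection_diagonal_apply]

theorem flat_shadow (γ : ℝ) (z : Cube5 n) :
    flat (shadow (diagonalSubmodule 5 (Cube n)) γ z) =
      (1 / (1 + γ)) • (flat z + γ • (matS n).mulVec (flat z)) := by
  rw [← flat_starProjection_diagonal]
  rfl

theorem flat_proj_sub {u u' w w' : Cube5 n} (hu : ∀ i, u i ∈ proj (sudokuSets given i) (w i))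
    (hu' : ∀ i, u' i ∈ proj (sudokuSets given i) (w' i)) (heq : ∀ i ≠ 4, u i = u' i) :
    flat (u - u') = (matC given).mulVec (flat (w - w')) := by
  ext ⟨i, p⟩
  rw [matC, Matrix.mulVec_diagonal]
  simp only [flat, PiLp.sub_apply]
  by_cases hi : i = 4
  · subst hi
    by_cases hp : given p.1 p.2.1 = none
    · simp [hp, proj_C₅_apply_blank (hu 4) hp, proj_C₅_apply_blank (hu' 4) hp]
    · simp [hp, C₅_apply_eq (hu 4).1 (hu' 4).1 hp]
  · simp [hi, heq i hi]

theorem IsDDRSequence.flat_sub_succ {γ : ℝ} {u x z : ℕ → Cube5 n}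
    (h : IsDDRSequence γ (sudokuSets given) u x z) (hγ : 1 + γ ≠ 0) {k : ℕ}
    (heq : ∀ i ≠ 4, u (k + 2) i = u (k + 1) i) :
    flat (z (k + 2) - z (k + 1)) = (iterationMatrix γ given).mulVec (flat (z (k + 1) - z k)) := by
  set B := shadow (diagonalSubmodule 5 (Cube n)) γ
  have hstep : z (k + 2) - z (k + 1) =
      z (k + 1) - z k + (u (k + 2) - u (k + 1)) - B (z (k + 1) - z k) := by
    rw [h.u_succ (k + 1), h.u_succ k, map_sub]
    abel
  have hproj := flat_proj_sub (fun i => (h (k + 1) i).2.1) (fun i => (h k i).2.1) heq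
    (w := (2 : ℝ) • x (k + 2) - z (k + 1)) (w' := (2 : ℝ) • x (k + 1) - z k)
  have hreflect : (2 : ℝ) • x (k + 2) - z (k + 1) - ((2 : ℝ) • x (k + 1) - z k) =
      (2 : ℝ) • B (z (k + 1) - z k) - (z (k + 1) - z k) := by
    rw [h.x_succ (k + 1), h.x_succ k, map_sub]
    module
  rw [hreflect] at hproj
  rw [hstep]
  generalize z (k + 1) - z k = d at *
  rw [flat_sub, flat_add, hproj, flat_sub, flat_smul, flat_shadow, iterationMatrix]
  simp only [Matrix.smul_mulVec, Matrix.add_mulVec, Matrix.sub_mulVec, Matrix.one_mulVec,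
    ← Matrix.mulVec_mulVec, Matrix.mulVec_sub, Matrix.mulVec_add, Matrix.mulVec_smul]
  match_scalars <;> field_simp <;> ring

end Coordinates

section Diagonalization

variable {𝕜 V : Type*} [Field 𝕜] [AddCommGroup V] [Module 𝕜 V]

theorem ker_aeval_prod_eq_iSup {ι : Type*} (f : Module.End 𝕜 V) {p : ι → Polynomial 𝕜}
    (hp : Pairwise fun i j => IsCoprime (p i) (p j)) (s : Finset ι) :
    (aeval f (∏ i ∈ s, p i)).ker = ⨆ i ∈ s, (aeval f (p i)).ker := by
  classical
  induction s using Finset.induction_on with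
  | empty => simp [Module.End.one_eq_id]
  | insert i s hi ih =>
    rw [Finset.prod_insert hi, Finset.iSup_insert, ← ih]
    refine (Polynomial.sup_ker_aeval_eq_ker_aeval_mul_of_coprime f ?_).symm
    exact IsCoprime.prod_right fun j hj => hp (ne_of_mem_of_not_mem hj hi).symm

variable {ι : Type*} [Fintype ι] {μ : ι → 𝕜}

theorem iSup_eigenspace_eq_top (hμ : Function.Injective μ) {f : Module.End 𝕜 V}
    (hf : aeval f (∏ i, (X - Polynomial.C (μ i))) = 0) :
    ⨆ i, f.eigenspace (μ i) = ⊤ := by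
  have hker := ker_aeval_prod_eq_iSup f (Polynomial.pairwise_coprime_X_sub_C hμ) Finset.univ
  rw [hf, LinearMap.ker_zero] at hker
  rw [hker]
  simp [Module.End.eigenspace_def, Module.algebraMap_end_eq_smul_id,
    ← Algebra.algebraMap_eq_smul_one]

theorem ker_sq_sub_smul_eq_ker (hμ : Function.Injective μ) {f : Module.End 𝕜 V}
    (hf : aeval f (∏ i, (X - Polynomial.C (μ i))) = 0) (η : 𝕜) :
    ((f - η • 1) ^ 2).ker = (f - η • 1).ker := by
  have hsq : Squarefree (∏ i, (X - Polynomial.C (μ i))) :=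
    (Polynomial.separable_prod_X_sub_C_iff.2 hμ).squarefree
  have hss := (Module.End.isSemisimple_of_squarefree_aeval_eq_zero hsq hf).isFinitelySemisimple
  have h := hss.genEigenspace_eq_eigenspace η (k := (2 : ℕ)) (by norm_num)
  rwa [Module.End.genEigenspace_nat, Module.End.eigenspace_def] at h

end Diagonalization

section Orbit

theorem isBigO_pow_apply_of_iSup_eigenspace_eq_top {V : Type*} [NormedAddCommGroup V]
    [NormedSpace ℝ V] {f : Module.End ℝ V} {ι : Type*} {μ : ι → ℝ}
    (hf : ⨆ i, f.eigenspace (μ i) = ⊤) {r : ℝ} (hr : ∀ i, |μ i| ≤ r) (v : V) :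
    (fun k : ℕ => (f ^ k) v) =O[atTop] fun k => r ^ k := by
  have hv : v ∈ ⨆ i, f.eigenspace (μ i) := hf ▸ Submodule.mem_top
  induction hv using Submodule.iSup_induction' with
  | zero => simpa using Asymptotics.isBigO_zero _ _
  | add v w _ _ hv hw => simpa using hv.add hw
  | mem i v hv =>
    have hpow : ∀ k : ℕ, (f ^ k) v = μ i ^ k • v := fun k => by
      induction k with
      | zero => simp
      | succ k ih =>
        rw [pow_succ', Module.End.mul_apply, ih, map_smul, Module.End.mem_eigenspace_iff.1 hv,
          smul_smul, pow_succ]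
    refine .of_norm_left (.of_bound ‖v‖ (.of_forall fun k => ?_))
    rw [hpow, norm_norm, norm_smul, mul_comm, norm_pow, norm_pow]
    gcongr
    exact (hr i).trans (le_abs_self r)

end Orbit

section TwoIdempotents

variable {A : Type*} [Ring A] [Algebra ℝ A] {P S : A} {γ c l m : ℝ}

/-- The iteration operator `M_γ` of the damped Douglas–Rachford method in terms of the projections
`P` and `S` onto the two linear constraint spaces, in an arbitrary algebra. -/
def iterationOperator (γ : ℝ) (P S : A) : A :=
  (1 / (1 + γ)) • (γ • (1 + (2 : ℝ) • (P * S) - P - S) + P)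

theorem iterationOperator_mul_right (hγ : 1 + γ ≠ 0) (hS : S * S = S) :
    iterationOperator γ P S * S = P * S := by
  simp only [iterationOperator, smul_mul_assoc, add_mul, sub_mul, one_mul, mul_assoc, hS]
  match_scalars <;> field_simp <;> ring

theorem iterationOperator_mul_left (hP : P * P = P) (hPS : P * S * P = c • P) :
    iterationOperator γ P S * P =
      ((1 + 2 * γ * c) / (1 + γ)) • P - (γ / (1 + γ)) • (S * P) := by
  simp only [iterationOperator, smul_mul_assoc, add_mul, sub_mul, one_mul, hP, hPS]
  match_scalars <;> field_simp
  ring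

theorem iterationOperator_sub (hγ : 1 + γ ≠ 0) :
    iterationOperator γ P S - (γ / (1 + γ)) • 1 =
      P * ((1 / (1 + γ)) • (γ • ((2 : ℝ) • S - 1) + 1)) - (γ / (1 + γ)) • S := by
  simp only [iterationOperator, mul_smul_comm, mul_add, mul_sub, mul_one]
  match_scalars <;> field_simp
  ring

theorem iterationOperator_mul_mul_left (hγ : 1 + γ ≠ 0) (hS : S * S = S) (hP : P * P = P)
    (hPS : P * S * P = c • P) :
    iterationOperator γ P S * (iterationOperator γ P S * P) =
      ((1 + 2 * γ * c) / (1 + γ)) • (iterationOperator γ P S * P) - (γ / (1 + γ) * c) • P := by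
  rw [iterationOperator_mul_left hP hPS, mul_sub, mul_smul_comm, mul_smul_comm, ← mul_assoc,
    iterationOperator_mul_right hγ hS, iterationOperator_mul_left hP hPS, hPS]
  module

theorem iterationOperator_annihilated (hγ : 1 + γ ≠ 0) (hS : S * S = S) (hP : P * P = P)
    (hPS : P * S * P = c • P) (hsum : l + m = (1 + 2 * γ * c) / (1 + γ))
    (hprod : l * m = γ / (1 + γ) * c) :
    aeval (iterationOperator γ P S)
      (∏ i, (X - Polynomial.C (![0, l, γ / (1 + γ), m] i))) = 0 := by
  set M := iterationOperator γ P S with hM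
  set Q := (M - l • 1) * (M - m • 1) with hQ
  have hQP : Q * P = 0 := by
    have hMMP := iterationOperator_mul_mul_left hγ hS hP hPS
    rw [← hM, ← hsum, ← hprod] at hMMP
    simp only [hQ, mul_assoc, sub_mul, mul_sub, smul_mul_assoc, one_mul, mul_smul_comm, hMMP]
    module
  have hQM : Q * M = M * Q := by
    rw [hQ]
    noncomm_ring
  have hfactor : M * Q * (M - (γ / (1 + γ)) • 1) = 0 := by
    have hMS : Q * M * S = 0 := by
      rw [mul_assoc, iterationOperator_mul_right hγ hS, ← mul_assoc, hQP, zero_mul]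
    rw [hM, iterationOperator_sub hγ, ← hM, mul_sub, ← mul_assoc, mul_assoc M, hQP, ← hQM,
      mul_smul_comm _ _ S, hMS, mul_zero, zero_mul, smul_zero, sub_zero]
  have hpoly : ∏ i, (X - Polynomial.C (![0, l, γ / (1 + γ), m] i)) =
      X * ((X - Polynomial.C l) * (X - Polynomial.C m)) * (X - Polynomial.C (γ / (1 + γ))) := by
    simp only [Fin.prod_univ_four, Matrix.cons_val, map_zero, sub_zero]
    ring
  rw [hpoly, ← hfactor]
  simp only [hQ, map_mul, map_sub, Polynomial.aeval_X, Polynomial.aeval_C,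
    Algebra.algebraMap_eq_smul_one]

theorem iterationOperator_mul_eigenvector (hγ : 1 + γ ≠ 0) (hS : S * S = S) (hP : P * P = P)
    (hPS : P * S * P = c • P)
    (hl : l ^ 2 = (1 + 2 * γ * c) / (1 + γ) * l - γ / (1 + γ) * c) :
    iterationOperator γ P S * (l • P - (γ / (1 + γ)) • (S * P)) =
      l • (l • P - (γ / (1 + γ)) • (S * P)) := by
  rw [mul_sub, mul_smul_comm, mul_smul_comm, ← mul_assoc, iterationOperator_mul_right hγ hS, hPS,
    iterationOperator_mul_left hP hPS]
  match_scalars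
  · linear_combination -hl
  · ring

theorem smul_sub_smul_mul_ne_zero {ρ : ℝ} (hP : P * P = P) (hPS : P * S * P = c • P) (hP0 : P ≠ 0)
    (hl : l ≠ ρ * c) : l • P - ρ • (S * P) ≠ 0 := fun h => by
  have hmul : P * (l • P - ρ • (S * P)) = (l - ρ * c) • P := by
    rw [mul_sub, mul_smul_comm, mul_smul_comm, hP, ← mul_assoc, hPS]
    module
  rw [h, mul_zero] at hmul
  exact smul_ne_zero (sub_ne_zero.2 hl) hP0 hmul.symm

end TwoIdempotents

section LinearRecurrence

variable {E : Type*} [NormedAddCommGroup E] {z : ℕ → E} {r : ℝ}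

theorem exists_tendsto_of_isBigO_sub [CompleteSpace E] (hr0 : 0 < r) (hr1 : r < 1)
    (h : (fun k => z (k + 1) - z k) =O[atTop] fun k => r ^ k) :
    ∃ z', Tendsto z atTop (𝓝 z') ∧ (fun k => z k - z') =O[atTop] fun k => r ^ k := by
  obtain ⟨c, hc⟩ := (Asymptotics.isBigO_nat_atTop_iff
    fun k hk => absurd hk (pow_ne_zero k hr0.ne')).1 h
  have hgeom : ∀ k, dist (z k) (z (k + 1)) ≤ c * r ^ k := fun k => by
    rw [dist_comm, dist_eq_norm]
    exact (hc k).trans_eq (by rw [Real.norm_of_nonneg (pow_nonneg hr0.le k)])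
  obtain ⟨z', hz'⟩ := cauchySeq_tendsto_of_complete (cauchySeq_of_le_geometric r c hr1 hgeom)
  refine ⟨z', hz', .of_bound (c / (1 - r)) (.of_forall fun k => ?_)⟩
  rw [← dist_eq_norm, Real.norm_of_nonneg (pow_nonneg hr0.le k), div_mul_eq_mul_div]
  exact dist_le_of_le_geometric_of_tendsto r c hr1 hgeom hz' k

variable [NormedSpace ℝ E] {f : Module.End ℝ E}

theorem isBigO_sub_of_linear_recurrence (hr : r ≠ 0)
    (hf : ∀ v, (fun k => (f ^ k) v) =O[atTop] fun k => r ^ k)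
    (hz : ∀ᶠ k in atTop, z (k + 2) - z (k + 1) = f (z (k + 1) - z k)) :
    (fun k => z (k + 1) - z k) =O[atTop] fun k => r ^ k := by
  obtain ⟨K, hK⟩ := eventually_atTop.1 hz
  have horbit : ∀ k, z (k + K + 1) - z (k + K) = (f ^ k) (z (K + 1) - z K) := fun k => by
    induction k with
    | zero => simp
    | succ k ih =>
      rw [pow_succ', Module.End.mul_apply, ← ih, ← hK _ (Nat.le_add_left K k)]
      congr 2 <;> ring
  rw [← map_add_atTop_eq_nat K, Asymptotics.isBigO_map]
  refine ((hf (z (K + 1) - z K)).congr_left fun k => (horbit k).symm).trans ?_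
  refine .of_bound |r ^ K|⁻¹ (.of_forall fun k => ?_)
  rw [Function.comp_apply, pow_add, norm_mul, mul_comm ‖r ^ k‖, Real.norm_eq_abs (r ^ K),
    inv_mul_cancel_left₀ (by positivity)]

theorem eventually_sub_eq_of_linear_recurrence (hf : Continuous f) {z' : E}
    (hz' : Tendsto z atTop (𝓝 z'))
    (hz : ∀ᶠ k in atTop, z (k + 2) - z (k + 1) = f (z (k + 1) - z k)) :
    ∀ᶠ k in atTop, z (k + 1) - z' = f (z k - z') := by
  have hconst : EventuallyConst (fun k => z (k + 1) - f (z k)) atTop := by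
    obtain ⟨K, hK⟩ := eventually_atTop.1 hz
    refine eventuallyConst_atTop_nat.2 ⟨K, fun k hk => ?_⟩
    have := hK k hk
    rw [map_sub] at this
    exact sub_eq_sub_iff_sub_eq_sub.1 this
  obtain ⟨c, hc⟩ := eventuallyConst_iff_exists_eventuallyEq.1 hconst
  have hlim : z' - f z' = c := tendsto_nhds_unique
    ((hz'.comp (tendsto_add_atTop_nat 1)).sub ((hf.tendsto z').comp hz'))
    (tendsto_const_nhds.congr' hc.symm)
  filter_upwards [hc] with k hk
  rw [map_sub, ← sub_eq_sub_iff_sub_eq_sub, hk, hlim]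

end LinearRecurrence

section Rate

/-- The eigenvalue of the iteration matrix that is conjugate to `rate γ`. -/
def rateConj (γ : ℝ) : ℝ := (2 * γ + 5 - Real.sqrt (25 - 16 * γ ^ 2)) / (10 * (1 + γ))

/-- The possible eigenvalues of the iteration matrix, in increasing order. -/
def iterationEigenvalues (γ : ℝ) : Fin 4 → ℝ := ![0, rateConj γ, γ / (1 + γ), rate γ]

variable {γ : ℝ}

theorem rateConj_add_rate (hγ : 1 + γ ≠ 0) :
    rateConj γ + rate γ = (1 + 2 * γ * (1 / 5)) / (1 + γ) := by
  rw [rateConj, rate]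
  field_simp
  ring

theorem rateConj_mul_rate (hγ0 : 0 ≤ γ) (hγ1 : γ ≤ 1) :
    rateConj γ * rate γ = γ / (1 + γ) * (1 / 5) := by
  have hsq : Real.sqrt (25 - 16 * γ ^ 2) ^ 2 = 25 - 16 * γ ^ 2 := Real.sq_sqrt (by nlinarith)
  rw [rateConj, rate]
  generalize Real.sqrt (25 - 16 * γ ^ 2) = s at *
  field_simp
  linear_combination -5 * hsq

theorem sqrt_discriminant_lt (hγ : γ ≠ 0) : Real.sqrt (25 - 16 * γ ^ 2) < 5 :=
  (Real.sqrt_lt' (by norm_num)).2 (by linarith [pow_pos (abs_pos.2 hγ) 2, sq_abs γ])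

theorem abs_lt_sqrt_discriminant (hγ0 : 0 < γ) (hγ1 : γ < 1) :
    |5 - 8 * γ| < Real.sqrt (25 - 16 * γ ^ 2) :=
  Real.lt_sqrt_of_sq_lt (by rw [sq_abs]; nlinarith)

theorem strictMono_iterationEigenvalues (hγ0 : 0 < γ) (hγ1 : γ < 1) :
    StrictMono (iterationEigenvalues γ) := by
  have hlt := sqrt_discriminant_lt hγ0.ne'
  have habs := abs_lt.1 (abs_lt_sqrt_discriminant hγ0 hγ1)
  have h0 : 0 < rateConj γ := div_pos (by linarith) (by positivity)
  have h1 : rateConj γ < γ / (1 + γ) := by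
    rw [rateConj, div_lt_div_iff₀ (by positivity) (by positivity)]
    nlinarith
  have h2 : γ / (1 + γ) < rate γ := by
    rw [rate, div_lt_div_iff₀ (by positivity) (by positivity)]
    nlinarith
  rw [Fin.strictMono_iff_lt_succ]
  intro i
  fin_cases i
  exacts [h0, h1, h2]

theorem rate_pos (hγ : 0 < γ) : 0 < rate γ :=
  div_pos (by positivity) (by positivity)

theorem rate_lt_one (hγ : 0 < γ) : rate γ < 1 := by
  rw [rate, div_lt_one (by positivity)]
  linarith [sqrt_discriminant_lt hγ.ne']

theorem abs_iterationEigenvalues_le (hγ0 : 0 < γ) (hγ1 : γ < 1) (i : Fin 4) :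
    |iterationEigenvalues γ i| ≤ rate γ := by
  have hmono := (strictMono_iterationEigenvalues hγ0 hγ1).monotone
  rw [abs_of_nonneg (hmono (Fin.zero_le i))]
  exact hmono (Fin.le_last i)

end Rate

section IterationMatrix

variable {n : ℕ} {given : Grid n} {γ : ℝ}

theorem matS_mul_matS : matS n * matS n = matS n := by
  rw [matS, ← Matrix.mul_kronecker_mul, mul_one]
  congr 1
  ext i j
  simp [Matrix.mul_apply]

theorem matC_mul_matC : matC given * matC given = matC given := by
  rw [matC, Matrix.diagonal_mul_diagonal]
  simp

theorem matC_mul_matS_mul_matC :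
    matC given * matS n * matC given = (1 / 5 : ℝ) • matC given := by
  ext ⟨i, p⟩ ⟨j, q⟩
  simp only [matC, matS, Matrix.mul_diagonal, Matrix.diagonal_mul, Matrix.kroneckerMap_apply,
    Matrix.smul_apply, Matrix.diagonal_apply, Matrix.one_apply, Matrix.of_apply, Prod.mk.injEq]
  split_ifs <;> simp_all

theorem matC_ne_zero (h : ∃ i j, given i j = none) : matC given ≠ 0 := by
  obtain ⟨i, j, hij⟩ := h
  intro h0
  have := congr_fun₂ h0 (4, i, j, i) (4, i, j, i)
  simp [matC, hij] at this

theorem aeval_iterationMatrix (hγ0 : 0 ≤ γ) (hγ1 : γ ≤ 1) :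
    aeval (iterationMatrix γ given).toLin'
      (∏ i, (X - Polynomial.C (iterationEigenvalues γ i))) = 0 := by
  have hγ : 1 + γ ≠ 0 := by positivity
  have h := iterationOperator_annihilated hγ matS_mul_matS (matC_mul_matC (given := given))
    matC_mul_matS_mul_matC (rateConj_add_rate hγ) (rateConj_mul_rate hγ0 hγ1)
  exact (Polynomial.aeval_algHom_apply Matrix.toLinAlgEquiv' _ _).trans
    ((congrArg _ h).trans (map_zero _))

theorem hasEigenvalue_toLin'_of_mul_eq_smul {ι R : Type*} [Fintype ι] [DecidableEq ι]
    [CommRing R] {M N : Matrix ι ι R} {μ : R} (h : M * N = μ • N) (hN : N ≠ 0) :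
    Module.End.HasEigenvalue M.toLin' μ := by
  obtain ⟨j, hj⟩ : ∃ j, N.col j ≠ 0 := by
    contrapose! hN
    ext i j
    exact congr_fun (hN j) i
  refine Module.End.hasEigenvalue_of_hasEigenvector (x := N.col j)
    ⟨Module.End.mem_eigenspace_iff.2 ?_, hj⟩
  ext i
  exact congr_fun₂ h i j

theorem hasEigenvalue_rate (hγ0 : 0 < γ) (hγ1 : γ < 1) (h : ∃ i j, given i j = none) :
    Module.End.HasEigenvalue (iterationMatrix γ given).toLin' (rate γ) := by
  have hγ : 1 + γ ≠ 0 := by positivity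
  have hroot : rate γ ^ 2 =
      (1 + 2 * γ * (1 / 5)) / (1 + γ) * rate γ - γ / (1 + γ) * (1 / 5) := by
    rw [← rateConj_add_rate hγ, ← rateConj_mul_rate hγ0.le hγ1.le]
    ring
  have hne : rate γ ≠ γ / (1 + γ) * (1 / 5) := by
    have hlt : γ / (1 + γ) < rate γ :=
      strictMono_iterationEigenvalues hγ0 hγ1 (show (2 : Fin 4) < 3 by decide)
    have : 0 < γ / (1 + γ) := by positivity
    linarith
  exact hasEigenvalue_toLin'_of_mul_eq_smul
    (iterationOperator_mul_eigenvector hγ matS_mul_matS matC_mul_matC matC_mul_matS_mul_matC hroot)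
    (smul_sub_smul_mul_ne_zero matC_mul_matC matC_mul_matS_mul_matC (matC_ne_zero h) hne)

theorem rank_eq_rank_sq_of_ker {ι K : Type*} [Fintype ι] [DecidableEq ι] [Field K]
    {N : Matrix ι ι K} (h : (N.toLin' ^ 2).ker = N.toLin'.ker) : N.rank = (N ^ 2).rank := by
  have h₁ := N.toLin'.finrank_range_add_finrank_ker
  have h₂ := (N.toLin' ^ 2).finrank_range_add_finrank_ker
  rw [h, ← Matrix.toLin'_pow] at h₂
  change Module.finrank K N.toLin'.range = Module.finrank K (N ^ 2).toLin'.range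
  lia

theorem isSemisimpleEigenvalue_rate (hγ0 : 0 < γ) (hγ1 : γ < 1) (h : ∃ i j, given i j = none) :
    IsSemisimpleEigenvalue (iterationMatrix γ given) (rate γ) := by
  refine ⟨hasEigenvalue_rate hγ0 hγ1 h, rank_eq_rank_sq_of_ker ?_⟩
  rw [map_sub, map_smul, Matrix.toLin'_one]
  exact ker_sq_sub_smul_eq_ker (strictMono_iterationEigenvalues hγ0 hγ1).injective
    (aeval_iterationMatrix hγ0.le hγ1.le) (rate γ)

theorem isBigO_pow_toLin'_iterationMatrix (hγ0 : 0 < γ) (hγ1 : γ < 1) (v : Fin 5 × Pos n → ℝ) :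
    (fun k : ℕ => ((iterationMatrix γ given).toLin' ^ k) v) =O[atTop] fun k => rate γ ^ k :=
  isBigO_pow_apply_of_iSup_eigenspace_eq_top
    (iSup_eigenspace_eq_top (strictMono_iterationEigenvalues hγ0 hγ1).injective
      (aeval_iterationMatrix hγ0.le hγ1.le))
    (abs_iterationEigenvalues_le hγ0 hγ1) v

end IterationMatrix

section Convergence

variable {n : ℕ} {given : Grid n} {γ : ℝ} {u x z : ℕ → Cube5 n}

namespace IsDDRSequence

theorem eventually_u_succ_eq (h : IsDDRSequence γ (sudokuSets given) u x z) (hγ0 : 0 < γ)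
    (hγ1 : γ < 1) : ∀ᶠ k in atTop, ∀ i ≠ 4, u (k + 2) i = u (k + 1) i := by
  have hu := h.tendsto_u_sub hγ0 hγ1
  refine eventually_all.2 fun i => eventually_imp_distrib_left.2 fun hi => ?_
  exact eventually_succ_eq_of_pairwise_le_dist (f := fun k => u (k + 1) i) one_pos
    (pairwise_one_le_dist_sudokuSets hi) (fun k => h.u_succ_mem k i)
    (((PiLp.continuous_apply 2 _ i).tendsto' 0 0 rfl).comp hu)

theorem eventually_flat_sub_succ (h : IsDDRSequence γ (sudokuSets given) u x z) (hγ0 : 0 < γ)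
    (hγ1 : γ < 1) : ∀ᶠ k in atTop, flat (z (k + 2)) - flat (z (k + 1)) =
      (iterationMatrix γ given).toLin' (flat (z (k + 1)) - flat (z k)) :=
  (h.eventually_u_succ_eq hγ0 hγ1).mono fun _ hk => h.flat_sub_succ (by positivity) hk

theorem exists_tendsto (h : IsDDRSequence γ (sudokuSets given) u x z) (hγ0 : 0 < γ)
    (hγ1 : γ < 1) : ∃ z', Tendsto z atTop (𝓝 z') ∧
      (fun k => ‖z k - z'‖) =O[atTop] (fun k => rate γ ^ k) ∧
      ∀ᶠ k in atTop, flat (z (k + 1) - z') =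
        (iterationMatrix γ given).mulVec (flat (z k - z')) := by
  have hrec := h.eventually_flat_sub_succ hγ0 hγ1
  have hsub := isBigO_sub_of_linear_recurrence (z := fun k => flat (z k)) (rate_pos hγ0).ne'
    (isBigO_pow_toLin'_iterationMatrix hγ0 hγ1) hrec
  obtain ⟨v, hv, hO⟩ := exists_tendsto_of_isBigO_sub (z := fun k => flat (z k)) (rate_pos hγ0)
    (rate_lt_one hγ0) hsub
  refine ⟨(flatEquiv n).symm v, ((flatEquiv n).symm.continuous.tendsto v).comp hv,
    (((flatEquiv n).symm.isBigO_comp _ _).trans hO).norm_left, ?_⟩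
  exact eventually_sub_eq_of_linear_recurrence
    (LinearMap.continuous_of_finiteDimensional _) hv hrec

theorem eventually_u_eq (h : IsDDRSequence γ (sudokuSets given) u x z) {x' : Cube5 n}
    (hu : Tendsto u atTop (𝓝 x')) : ∀ᶠ k in atTop, ∀ i ≠ 4, u k i = x' i := by
  refine eventually_all.2 fun i => eventually_imp_distrib_left.2 fun hi => ?_
  rw [← map_add_atTop_eq_nat 1, eventually_map]
  exact eventually_eq_of_pairwise_le_dist one_pos (pairwise_one_le_dist_sudokuSets hi)
    (fun k => h.u_succ_mem k i)
    (((PiLp.continuous_apply 2 _ i).tendsto x').comp (hu.comp (tendsto_add_atTop_nat 1)))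

end IsDDRSequence

end Convergence

end DampedDR

end

open DampedDR Filter Topology in
theorem proposition4p8_general {n : ℕ} {given : Grid n} {γ : ℝ} (hγ0 : 0 < γ) (hγ1 : γ < 1)
    {u x z : ℕ → Cube5 n} (hseq : IsDDRSequence γ (sudokuSets given) u x z) :
    (∃ xs zs : Cube5 n,
      Tendsto u atTop (𝓝 xs) ∧ Tendsto x atTop (𝓝 xs) ∧ Tendsto z atTop (𝓝 zs) ∧
      zs ∈ ddrOperator γ (prodSet (sudokuSets given)) (diagonalSet 5 (Cube n)) zs ∧
      xs ∈ relaxedProj (γ / (1 + γ)) (diagonalSet 5 (Cube n)) zs ∧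
      IsStationaryPoint (fun y => Metric.infDist y (diagonalSet 5 (Cube n)) ^ 2)
        (prodSet (sudokuSets given)) xs ∧
      (∀ᶠ k in atTop, ∀ i : Fin 5, i ≠ 4 → u k i = xs i) ∧
      (fun k => ‖z k - zs‖) =O[atTop] (fun k : ℕ => rate γ ^ k) ∧
      ∀ᶠ k in atTop, flat (z (k + 1) - zs) =
        Matrix.mulVec (iterationMatrix γ given) (flat (z k - zs))) ∧
    ((∃ i j, given i j = none) →
      IsSemisimpleEigenvalue (iterationMatrix γ given) (rate γ)) := by
  have hγ : 1 + γ ≠ 0 := by positivity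
  obtain ⟨zs, hz, hO, hrec⟩ := hseq.exists_tendsto hγ0 hγ1
  have hu := hseq.tendsto_u hz
  have hfix : zs ∈ ddrOperator γ (prodSet (sudokuSets given)) (diagonalSet 5 (Cube n)) zs :=
    mem_ddrOperator_of_tendsto (diagonalSubmodule 5 (Cube n)) hγ
      (isClosed_prodSet isClosed_sudokuSets) hz (hseq.mem_ddrOperator hγ)
  refine ⟨⟨_, zs, hu, hseq.tendsto_x hz, hz, hfix,
    ?_, ?_, hseq.eventually_u_eq hu, hO, hrec⟩,
    isSemisimpleEigenvalue_rate hγ0 hγ1⟩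
  · exact (relaxedProj_submodule (diagonalSubmodule 5 (Cube n)) hγ zs).superset rfl
  · exact isStationaryPoint_shadow (diagonalSubmodule 5 (Cube n)) hγ0 hfix

theorem proposition4p8 (n : ℕ) (given : DampedDR.Grid n)
    (hfeas : (DampedDR.prodSet (DampedDR.sudokuSets given) ∩
      DampedDR.diagonalSet 5 (DampedDR.Cube n)).Nonempty)
    (γ : ℝ) (hγ0 : 0 < γ) (hγ1 : γ < Real.sqrt (3 / 2) - 1)
    (u x z : ℕ → DampedDR.Cube5 n)
    (hseq : DampedDR.IsDDRSequence γ (DampedDR.sudokuSets given) u x z) :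
    (∃ xs zs : DampedDR.Cube5 n,
      Filter.Tendsto u Filter.atTop (nhds xs) ∧
      Filter.Tendsto x Filter.atTop (nhds xs) ∧
      Filter.Tendsto z Filter.atTop (nhds zs) ∧
      zs ∈ DampedDR.ddrOperator γ (DampedDR.prodSet (DampedDR.sudokuSets given))
        (DampedDR.diagonalSet 5 (DampedDR.Cube n)) zs ∧
      xs ∈ DampedDR.relaxedProj (γ / (1 + γ)) (DampedDR.diagonalSet 5 (DampedDR.Cube n)) zs ∧
      DampedDR.IsStationaryPoint
        (fun y => Metric.infDist y (DampedDR.diagonalSet 5 (DampedDR.Cube n)) ^ 2)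
        (DampedDR.prodSet (DampedDR.sudokuSets given)) xs ∧
      ((∀ i : Fin 5, i ≠ 4 → xs i - zs i ∈
          interior (DampedDR.limitingNormalCone (DampedDR.sudokuSets given i) (xs i))) →
        (∀ᶠ k in Filter.atTop, ∀ i : Fin 5, i ≠ 4 → u k i = xs i) ∧
        ((fun k => ‖z k - zs‖) =O[Filter.atTop] fun k : ℕ => DampedDR.rate γ ^ k) ∧
        (∀ᶠ k in Filter.atTop, DampedDR.flat (z (k + 1) - zs) =
          Matrix.mulVec (DampedDR.iterationMatrix γ given) (DampedDR.flat (z k - zs))))) ∧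
    ((∃ i j, given i j = none) →
      DampedDR.IsSemisimpleEigenvalue (DampedDR.iterationMatrix γ given) (DampedDR.rate γ)) := by
  have hγ : γ < 1 := hγ1.trans (by rw [sub_lt_iff_lt_add, Real.sqrt_lt'] <;> norm_num)
  obtain ⟨⟨xs, zs, hu, hx, hz, hfix, hrelaxed, hstat, hlocal⟩, heig⟩ :=
    proposition4p8_general hγ0 hγ hseq
  exact ⟨⟨xs, zs, hu, hx, hz, hfix, hrelaxed, hstat, fun _ => hlocal⟩, heig⟩
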